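/- For a permutation $\pi\in S_n$ and an integer $d\ge 1$ let $c_d(\pi)$ denote the number of $d$-cycles of $\pi$ (so $c_1(\pi)$ is the number of fixed points). Let $\sigma_k(q)=\sum_{d\mid q}d^k$ and $H_r=\sum_{d=1}^r\frac1d$. There exist an absolute constant $C>0$ and an integer $q_0$ such that for all integers $q\ge q_0$, all integers $r$ with $1\le r\le \exp(q^{1/3})$, all integers $\delta$ with $1\le\delta\le\frac{\log q}{\log 2}$ and all integers $n\ge1$, $$\frac{1}{n!}\sum_{\pi\in S_n}\Bigl(\sum_{d=1}^r c_d(\pi^q)\Bigr)^{\delta}\le C\cdot\begin{cases}\sigma_0(q)H_r&\text{if }\delta=1,\\ \sigma_0(q)^2H_r^2+\sigma_1(q)H_r&\text{if }\delta=2,\\ q^2H_r&\text{if }\delta=3,\\ q^{\delta-1}H_r^2&\text{if }\delta\ge4.\end{cases}$$ -/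

import Mathlib

/-- `cycleCount d π` is the number `c_d(π)` of `d`-cycles of the permutation `π`
(the `1`-cycles are the fixed points): the multiplicity of `d` in the full cycle type of `π`. -/
def cycleCount {n : ℕ} (d : ℕ) (π : Equiv.Perm (Fin n)) : ℕ :=
  π.partition.parts.count d

/-- The mean over `π ∈ S_n` of `(∑_{d=1}^r c_d(π^q))^δ`. -/
noncomputable def cycleMoment (n q r δ : ℕ) : ℝ :=
  (1 / (n.factorial : ℝ)) *
    ∑ π : Equiv.Perm (Fin n), ((∑ d ∈ Finset.Icc 1 r, cycleCount d (π ^ q) : ℕ) : ℝ) ^ δ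

open Finset

/-! An m-cycle of `π` becomes gcd(m,q) cycles of length m / gcd(m,q) in `π ^ q`, so the quantity
averaged is an additive function of the cycle type, with weights w(m) = `splitCount q r m`.
Heuristically the numbers of m-cycles are independent Poisson(1/m) variables, and the sum is
compound Poisson with k-th cumulant ∑ w(m)^k / m. The pair (gcd, quotient) determines m, so this
cumulant is at most σ_{k-1}(q) H_r. For finite n, removing one cycle gives the moment recursion
exactly (`sum_partitionMultisets_map_sum_mul`), and induction bounds the δ-th moment by the compound
Poisson one, uniformly in n.

That moment is a sum over set partitions of δ points of products of cumulants over blocks. For δ ≤ 3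
it is written out. For δ ≥ 4, one block gives about q^(δ-1) H_r; two blocks give about 2^δ q^(δ-2)
H_r², where 2^δ ≤ q is used; three or more blocks are controlled by S(δ,k) ≤ k^δ / k!
(`compoundMoment_succ_le`). The divisor bound σ_0(q) ≤ q^(1/60) absorbs the losses from small
blocks. -/

/-! ### Cycles of a power of a permutation -/

theorem minimalPeriod_eq_card_support {α : Type*} [Fintype α] [DecidableEq α]
    {π c : Equiv.Perm α} (hc : c ∈ π.cycleFactorsFinset) {x : α} (hx : x ∈ c.support) :
    Function.minimalPeriod π x = #c.support := by
  have hcyc : c.IsCycle := (Equiv.Perm.mem_cycleFactorsFinset_iff.mp hc).1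
  have hce : c = π.cycleOf x := Equiv.Perm.cycle_is_cycleOf hx hc
  refine Nat.dvd_right_iff_eq.mp fun n => ?_
  rw [← Function.isPeriodicPt_iff_minimalPeriod_dvd, ← hcyc.orderOf, orderOf_dvd_iff_pow_eq_one,
    hcyc.pow_eq_one_iff' (Equiv.Perm.mem_support.mp hx), hce, Equiv.Perm.cycleOf_pow_apply_self,
    Function.IsPeriodicPt, Function.IsFixedPt, Equiv.Perm.iterate_eq_pow]

theorem card_minimalPeriod_eq {α : Type*} [Fintype α] [DecidableEq α] (π : Equiv.Perm α)
    {d : ℕ} (hd : 1 ≤ d) :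
    #{x | Function.minimalPeriod π x = d} = d * π.partition.parts.count d := by
  rw [Equiv.Perm.parts_partition, Multiset.count_add, Multiset.count_replicate]
  rcases hd.eq_or_lt with rfl | hd
  · have h0 : π.cycleType.count 1 = 0 := Multiset.count_eq_zero.mpr fun h =>
      lt_irrefl _ (Equiv.Perm.one_lt_of_mem_cycleType h)
    rw [h0, if_pos rfl, zero_add, one_mul, ← card_compl]
    congr 1
    ext x
    simp [Function.minimalPeriod_eq_one_iff_isFixedPt, Function.IsFixedPt]
  · rw [if_neg hd.ne, add_zero, Equiv.Perm.cycleType_def, Multiset.count_map]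
    have key : ({x | Function.minimalPeriod π x = d} : Finset α) =
        (π.cycleFactorsFinset.filter fun c => d = #c.support).biUnion Equiv.Perm.support := by
      ext x
      simp only [mem_filter, mem_univ, true_and, mem_biUnion]
      constructor
      · intro h
        have hx : x ∈ π.support := by
          rw [Equiv.Perm.mem_support]
          intro hf
          rw [Function.minimalPeriod_eq_one_iff_isFixedPt.mpr hf] at h
          omega
        have hc := Equiv.Perm.cycleOf_mem_cycleFactorsFinset_iff.mpr hx
        have hxc : x ∈ (π.cycleOf x).support :=
          Equiv.Perm.mem_support_cycleOf_iff.mpr ⟨Equiv.Perm.SameCycle.refl _ _, hx⟩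
        exact ⟨_, ⟨hc, by rw [← minimalPeriod_eq_card_support hc hxc, h]⟩, hxc⟩
      · rintro ⟨c, ⟨hc, hcd⟩, hx⟩
        rw [minimalPeriod_eq_card_support hc hx, hcd]
    rw [key, card_biUnion, sum_const_nat (m := d), mul_comm]
    · rfl
    · intro c hc
      exact (mem_filter.mp hc).2.symm
    · intro c hc c' hc' hne
      exact (π.cycleFactorsFinset_pairwise_disjoint (mem_filter.mp hc).1
        (mem_filter.mp hc').1 hne).disjoint_support

/-- The number of cycles of length at most `r` into which an `m`-cycle splits when it is raised to
the `q`-th power. -/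
def splitCount (q r m : ℕ) : ℕ := if m / m.gcd q ≤ r then m.gcd q else 0

theorem sum_cycleCount_pow {n : ℕ} (π : Equiv.Perm (Fin n)) {q : ℕ} (hq : 0 < q) (r : ℕ) :
    ∑ d ∈ Icc 1 r, cycleCount d (π ^ q) = (π.partition.parts.map (splitCount q r)).sum := by
  have hpos : ∀ x, 0 < Function.minimalPeriod π x := fun x =>
    Function.minimalPeriod_pos_of_mem_periodicPts
      (Function.mem_periodicPts.mpr ⟨orderOf π, orderOf_pos π, by
        rw [Function.IsPeriodicPt, Function.IsFixedPt, Equiv.Perm.iterate_eq_pow,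
          pow_orderOf_eq_one]; rfl⟩)
  have hle : ∀ x, Function.minimalPeriod π x ∈ Icc 1 n := fun x => by
    have := Function.minimalPeriod_le_card (f := π) (x := x)
    rw [Fintype.card_fin] at this
    exact mem_Icc.mpr ⟨hpos x, this⟩
  have hpow : ∀ x, Function.minimalPeriod (π ^ q : Equiv.Perm (Fin n)) x =
      Function.minimalPeriod π x / (Function.minimalPeriod π x).gcd q := fun x => by
    rw [← Equiv.Perm.iterate_eq_pow, Function.minimalPeriod_iterate_eq_div_gcd hq.ne']
  -- Count the points of period d under `π ^ q`, sorted by their period m under `π`; those m satisfy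
  -- m = d · gcd(m,q), so d cancels.
  have h1 : ∀ d ∈ Icc 1 r, cycleCount d (π ^ q) =
      ∑ m ∈ Icc 1 n, if m / m.gcd q = d then m.gcd q * π.partition.parts.count m else 0 := by
    intro d hd
    have hd1 := (mem_Icc.mp hd).1
    refine Nat.eq_of_mul_eq_mul_left hd1 ?_
    rw [cycleCount, ← card_minimalPeriod_eq _ hd1]
    simp_rw [hpow]
    rw [card_eq_sum_card_fiberwise (f := fun x => Function.minimalPeriod π x) (t := Icc 1 n)
      (fun x _ => hle x), mul_sum]
    refine sum_congr rfl fun m hm => ?_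
    rw [filter_filter]
    split_ifs with h
    · have : d * m.gcd q = m := by rw [← h]; exact Nat.div_mul_cancel (Nat.gcd_dvd_left m q)
      rw [← mul_assoc, this, ← card_minimalPeriod_eq _ (mem_Icc.mp hm).1]
      congr 1
      ext x
      simp only [mem_filter, mem_univ, true_and, and_iff_right_iff_imp]
      rintro rfl
      exact h
    · rw [mul_zero, card_eq_zero, filter_eq_empty_iff]
      rintro x - ⟨h2, h3⟩
      rw [h3] at h2
      exact h h2
  rw [sum_congr rfl h1, sum_comm, sum_multiset_map_count]
  have hsub : π.partition.parts.toFinset ⊆ Icc 1 n := by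
    intro m hm
    have hm := Multiset.mem_toFinset.mp hm
    have h2 := Multiset.le_sum_of_mem hm
    rw [π.partition.parts_sum, Fintype.card_fin] at h2
    exact mem_Icc.mpr ⟨π.partition.parts_pos hm, h2⟩
  rw [sum_subset hsub]
  · refine sum_congr rfl fun m hm => ?_
    have hm1 := (mem_Icc.mp hm).1
    have : 1 ≤ m / m.gcd q := Nat.div_pos (Nat.gcd_le_left _ hm1) (Nat.gcd_pos_of_pos_left _ hm1)
    rw [sum_ite_eq, splitCount]
    simp [this, mul_comm]
  · intro m _ hm
    rw [Multiset.count_eq_zero.mpr (by simpa using hm), zero_smul]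

/-! ### Averages over cycle types -/

/-- The partitions of `n`, as multisets of positive integers. -/
def partitionMultisets (n : ℕ) : Finset (Multiset ℕ) :=
  (univ : Finset n.Partition).image Nat.Partition.parts

theorem mem_partitionMultisets {n : ℕ} {s : Multiset ℕ} :
    s ∈ partitionMultisets n ↔ (∀ m ∈ s, 0 < m) ∧ s.sum = n := by
  simp only [partitionMultisets, mem_image, mem_univ, true_and]
  constructor
  · rintro ⟨p, rfl⟩
    exact ⟨fun m hm => p.parts_pos hm, p.parts_sum⟩
  · rintro ⟨h, h'⟩
    exact ⟨⟨s, @fun m hm => h m hm, h'⟩, rfl⟩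

/-- The order of the centralizer of a permutation with full cycle type `s`. -/
def centralizerCard (s : Multiset ℕ) : ℕ := s.prod * ∏ m ∈ s.toFinset, (s.count m).factorial

theorem prod_count_factorial_of_subset {s : Multiset ℕ} {t : Finset ℕ} (h : s.toFinset ⊆ t) :
    ∏ m ∈ s.toFinset, (s.count m).factorial = ∏ m ∈ t, (s.count m).factorial := by
  refine prod_subset h fun m _ hm => ?_
  rw [Multiset.count_eq_zero.mpr (by simpa using hm), Nat.factorial_zero]

theorem centralizerCard_cons (m : ℕ) (s : Multiset ℕ) :
    centralizerCard (m ::ₘ s) = m * (s.count m + 1) * centralizerCard s := by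
  have h1 : s.toFinset ⊆ (m ::ₘ s).toFinset := by
    rw [Multiset.toFinset_cons]; exact subset_insert _ _
  have hm : m ∈ (m ::ₘ s).toFinset := by simp
  rw [centralizerCard, centralizerCard, prod_count_factorial_of_subset h1, Multiset.prod_cons,
    ← mul_prod_erase _ _ hm, ← mul_prod_erase (a := m) _ _ hm, Multiset.count_cons_self,
    Nat.factorial_succ]
  have : ∏ x ∈ (m ::ₘ s).toFinset.erase m, ((m ::ₘ s).count x).factorial =
      ∏ x ∈ (m ::ₘ s).toFinset.erase m, (s.count x).factorial := by
    refine prod_congr rfl fun x hx => ?_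
    rw [Multiset.count_cons_of_ne (mem_erase.mp hx).1]
  rw [this]
  ring

theorem centralizerCard_pos {s : Multiset ℕ} (h : ∀ m ∈ s, 0 < m) : 0 < centralizerCard s :=
  Nat.mul_pos (Multiset.prod_pos h) (prod_pos fun _ _ => Nat.factorial_pos _)

theorem card_partition_parts_eq {n : ℕ} {s : Multiset ℕ} (hs : s ∈ partitionMultisets n) :
    #{π : Equiv.Perm (Fin n) | π.partition.parts = s} * centralizerCard s = n.factorial := by
  obtain ⟨hpos, hsum⟩ := mem_partitionMultisets.mp hs
  -- `cycleType` omits fixed points, so the parts equal to 1 are split off; their number is n -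
  -- t.sum.
  set t := s.filter (2 ≤ ·) with ht
  have hone : s.filter (¬ 2 ≤ ·) = Multiset.replicate (s.count 1) 1 := by
    rw [← Multiset.filter_eq']
    refine Multiset.filter_congr fun m hm => ?_
    have := hpos m hm
    omega
  have hst : s = t + Multiset.replicate (s.count 1) 1 := by
    rw [← hone, ht, Multiset.filter_add_not]
  have hts : t.sum + s.count 1 = n := by
    rw [← hsum]
    conv_rhs => rw [hst]
    simp
  have ht2 : ∀ a ∈ t, 2 ≤ a := fun a ha => (Multiset.mem_filter.mp ha).2
  have hset : ∀ π : Equiv.Perm (Fin n), π.partition.parts = s ↔ π.cycleType = t := by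
    intro π
    constructor
    · intro h
      rw [← Equiv.Perm.filter_parts_partition_eq_cycleType, h]
    · intro h
      rw [Equiv.Perm.parts_partition, ← Equiv.Perm.sum_cycleType, h, Fintype.card_fin,
        show n - t.sum = s.count 1 by omega]
      exact hst.symm
  have h1t : 1 ∉ t.toFinset := fun h => by
    have := ht2 1 (Multiset.mem_toFinset.mp h)
    omega
  have hz : centralizerCard s =
      (Fintype.card (Fin n) - t.sum).factorial * t.prod *
        ∏ m ∈ t.toFinset, (t.count m).factorial := by
    have hsub : s.toFinset ⊆ insert 1 t.toFinset := by
      intro m hm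
      have hm := Multiset.mem_toFinset.mp hm
      rw [mem_insert, Multiset.mem_toFinset, ht, Multiset.mem_filter]
      have := hpos m hm
      by_cases h : m = 1
      · exact Or.inl h
      · exact Or.inr ⟨hm, by omega⟩
    have hp : s.prod = t.prod := by
      rw [hst]; simp
    have hc : ∀ m ∈ t.toFinset, (s.count m).factorial = (t.count m).factorial := by
      intro m hm
      rw [ht, Multiset.count_filter_of_pos (ht2 m (Multiset.mem_toFinset.mp hm))]
    rw [centralizerCard, prod_count_factorial_of_subset hsub, prod_insert h1t, hp,
      prod_congr rfl hc, Fintype.card_fin, show n - t.sum = s.count 1 by omega]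
    ring
  simp_rw [hset]
  rw [hz, Equiv.Perm.card_of_cycleType_mul_eq, if_pos, Fintype.card_fin]
  exact ⟨by rw [Fintype.card_fin]; omega, ht2⟩

theorem mean_perm_eq_sum_partitionMultisets (n : ℕ) (F : Multiset ℕ → ℝ) :
    (1 / (n.factorial : ℝ)) * ∑ π : Equiv.Perm (Fin n), F π.partition.parts =
      ∑ s ∈ partitionMultisets n, F s / centralizerCard s := by
  have hmem : ∀ π ∈ (univ : Finset (Equiv.Perm (Fin n))),
      π.partition.parts ∈ partitionMultisets n := fun π _ =>
    mem_partitionMultisets.mpr ⟨fun m hm => π.partition.parts_pos hm, by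
      rw [π.partition.parts_sum, Fintype.card_fin]⟩
  rw [← sum_fiberwise_of_maps_to hmem, mul_sum]
  refine sum_congr rfl fun s hs => ?_
  rw [sum_congr rfl (g := fun _ => F s) (fun π hπ => by rw [(mem_filter.mp hπ).2]), sum_const,
    nsmul_eq_mul]
  have h := congrArg (Nat.cast (R := ℝ)) (card_partition_parts_eq hs)
  have hz : (0 : ℝ) < centralizerCard s :=
    Nat.cast_pos.mpr (centralizerCard_pos (mem_partitionMultisets.mp hs).1)
  have hn : (0 : ℝ) < n.factorial := Nat.cast_pos.mpr n.factorial_pos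
  push_cast at h
  rw [eq_div_iff hz.ne', ← h]
  rw [← h] at hn
  have hc := (pos_of_mul_pos_left hn hz.le).ne'
  field_simp

/-- A size-biasing identity: marking a part m of s and removing it is a bijection onto pairs (m, t).
By `centralizerCard_cons`, the multiplicity of m in s cancels and only 1/m remains. -/
theorem sum_partitionMultisets_map_sum_mul (n : ℕ) (w : ℕ → ℝ) (F : Multiset ℕ → ℝ) :
    ∑ s ∈ partitionMultisets n, (s.map w).sum * F s / centralizerCard s =
      ∑ m ∈ Icc 1 n, w m / m *
        ∑ t ∈ partitionMultisets (n - m), F (m ::ₘ t) / centralizerCard t := by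
  simp_rw [sum_multiset_map_count, sum_mul, sum_div, mul_sum]
  rw [sum_sigma', sum_sigma']
  refine sum_bij' (i := fun p _ => ⟨p.2, p.1.erase p.2⟩) (j := fun p _ => ⟨p.1 ::ₘ p.2, p.1⟩)
    ?_ ?_ ?_ ?_ ?_
  · rintro ⟨s, m⟩ h
    simp only [mem_sigma, mem_partitionMultisets, Multiset.mem_toFinset, mem_Icc] at h ⊢
    obtain ⟨⟨h1, h2⟩, h3⟩ := h
    have h4 := Multiset.cons_erase h3
    have h5 : m + (s.erase m).sum = n := by rw [← Multiset.sum_cons, h4, h2]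
    exact ⟨⟨h1 m h3, by omega⟩, fun k hk => h1 k (Multiset.mem_of_mem_erase hk), by omega⟩
  · rintro ⟨m, t⟩ h
    simp only [mem_sigma, mem_partitionMultisets, Multiset.mem_toFinset, mem_Icc] at h ⊢
    obtain ⟨⟨h1, h2⟩, h3, h4⟩ := h
    refine ⟨⟨fun k hk => ?_, ?_⟩, Multiset.mem_cons_self _ _⟩
    · rcases Multiset.mem_cons.mp hk with rfl | hk
      · exact h1
      · exact h3 k hk
    · rw [Multiset.sum_cons]; omega
  · rintro ⟨s, m⟩ h
    simp only [mem_sigma, Multiset.mem_toFinset] at h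
    simp only [Multiset.cons_erase h.2]
  · rintro ⟨m, t⟩ h
    simp
  · rintro ⟨s, m⟩ h
    simp only [mem_sigma, mem_partitionMultisets, Multiset.mem_toFinset] at h ⊢
    obtain ⟨⟨h1, h2⟩, h3⟩ := h
    obtain ⟨t, rfl⟩ := Multiset.exists_cons_of_mem h3
    rw [Multiset.erase_cons_head, centralizerCard_cons, Multiset.count_cons_self]
    have hz : (0 : ℝ) < centralizerCard t :=
      Nat.cast_pos.mpr (centralizerCard_pos fun k hk => h1 k (Multiset.mem_cons_of_mem hk))
    have hm : (0 : ℝ) < m := Nat.cast_pos.mpr (h1 m h3)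
    push_cast
    rw [nsmul_eq_mul]
    push_cast
    field_simp

/-! ### Comparison with compound Poisson moments -/

/-- The moments of a compound Poisson variable with cumulants `ν`. -/
def compoundMoment (ν : ℕ → ℝ) : ℕ → ℝ
  | 0 => 1
  | k + 1 => ∑ i : Fin (k + 1), (k.choose i : ℝ) * ν (k + 1 - i) * compoundMoment ν i

theorem compoundMoment_succ (ν : ℕ → ℝ) (k : ℕ) :
    compoundMoment ν (k + 1) =
      ∑ i ∈ range (k + 1), (k.choose i : ℝ) * ν (k + 1 - i) * compoundMoment ν i := by
  rw [compoundMoment, Fin.sum_univ_eq_sum_range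
    (fun i => (k.choose i : ℝ) * ν (k + 1 - i) * compoundMoment ν i)]

/-- Size-biasing one factor of the power and expanding (w m + rest)^k yields the recursion of
`compoundMoment`. The remaining average is over partitions of n - m, so the induction hypothesis
must be uniform in n. -/
theorem sum_partitionMultisets_pow_le_compoundMoment {w : ℕ → ℝ} (hw : ∀ m, 0 ≤ w m)
    {ν : ℕ → ℝ} (hν : ∀ k n, 1 ≤ k → ∑ m ∈ Icc 1 n, w m ^ k / m ≤ ν k) (k n : ℕ) :
    ∑ s ∈ partitionMultisets n, (s.map w).sum ^ k / centralizerCard s ≤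
      compoundMoment ν k := by
  have hν0 : ∀ k, 1 ≤ k → 0 ≤ ν k := fun k hk => by simpa using hν k 0 hk
  induction k using Nat.strong_induction_on generalizing n with
  | _ k ih =>
  rcases k with _ | k
  -- The weights 1 / `centralizerCard s` have total mass 1 for every n.
  · have := mean_perm_eq_sum_partitionMultisets n (fun _ => 1)
    simp only [pow_zero, compoundMoment]
    rw [← this]
    simp [Fintype.card_perm, Nat.factorial_ne_zero]
  · have hpos : ∀ j, 0 ≤ compoundMoment ν j := by
      intro j
      induction j using Nat.strong_induction_on with
      | _ j ihj =>
      rcases j with _ | j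
      · simp [compoundMoment]
      · rw [compoundMoment_succ]
        refine sum_nonneg fun i hi => ?_
        have hi := mem_range.mp hi
        exact mul_nonneg (mul_nonneg (Nat.cast_nonneg _) (hν0 _ (by omega))) (ihj i hi)
    simp_rw [pow_succ']
    rw [sum_partitionMultisets_map_sum_mul n w fun s => (s.map w).sum ^ k, compoundMoment_succ]
    simp_rw [Multiset.map_cons, Multiset.sum_cons, add_comm (w _), add_pow, sum_div, mul_sum]
    calc _ = ∑ i ∈ range (k + 1), ∑ m ∈ Icc 1 n, (k.choose i : ℝ) * (w m ^ (k + 1 - i) / m) *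
          ∑ t ∈ partitionMultisets (n - m), (t.map w).sum ^ i / centralizerCard t := by
          rw [sum_comm]
          refine sum_congr rfl fun m _ => ?_
          simp_rw [mul_sum]
          rw [sum_comm]
          refine sum_congr rfl fun i hi => sum_congr rfl fun t _ => ?_
          have hi := mem_range.mp hi
          rw [show k + 1 - i = (k - i) + 1 by omega, pow_succ]
          ring
      _ ≤ ∑ i ∈ range (k + 1), ∑ m ∈ Icc 1 n, (k.choose i : ℝ) * (w m ^ (k + 1 - i) / m) *
          compoundMoment ν i := by
          gcongr with i hi m hm
          · exact mul_nonneg (Nat.cast_nonneg _)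
              (div_nonneg (pow_nonneg (hw m) _) (Nat.cast_nonneg _))
          · exact ih i (mem_range.mp hi) _
      _ ≤ _ := by
          refine sum_le_sum fun i hi => ?_
          have hi := mem_range.mp hi
          rw [← sum_mul, ← mul_sum]
          exact mul_le_mul_of_nonneg_right
            (mul_le_mul_of_nonneg_left (hν _ _ (by omega)) (Nat.cast_nonneg _)) (hpos i)

/-- With g = gcd(m,q) and e = m / g, the summand is g^(k-1) / e, and m ↦ (g, e) is injective into
divisors of q times [1, r]. -/
theorem sum_splitCount_pow_div_le {q : ℕ} (hq : 0 < q) (r k n : ℕ) (hk : 1 ≤ k) :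
    ∑ m ∈ Icc 1 n, (splitCount q r m : ℝ) ^ k / m ≤
      (ArithmeticFunction.sigma (k - 1) q : ℝ) * (harmonic r : ℝ) := by
  have hH : (harmonic r : ℝ) = ∑ e ∈ Icc 1 r, (1 : ℝ) / e := by
    rw [harmonic_eq_sum_Icc]; push_cast; simp
  rw [ArithmeticFunction.sigma_apply, hH]
  push_cast
  rw [sum_mul_sum, ← sum_product']
  set S := (Icc 1 n).filter fun m => m / m.gcd q ≤ r with hS
  have hinj : Set.InjOn (fun m : ℕ => (m.gcd q, m / m.gcd q)) (S : Set ℕ) := by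
    intro a _ b _ hab
    simp only [Prod.mk.injEq] at hab
    rw [← Nat.mul_div_cancel' (Nat.gcd_dvd_left a q), ← Nat.mul_div_cancel' (Nat.gcd_dvd_left b q),
      hab.2, hab.1]
  have hsub : S.image (fun m : ℕ => (m.gcd q, m / m.gcd q)) ⊆ q.divisors ×ˢ Icc 1 r := by
    intro p hp
    obtain ⟨m, hm, rfl⟩ := mem_image.mp hp
    obtain ⟨hm, hmr⟩ := mem_filter.mp hm
    have hm1 := (mem_Icc.mp hm).1
    exact mem_product.mpr ⟨Nat.mem_divisors.mpr ⟨Nat.gcd_dvd_right _ _, hq.ne'⟩,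
      mem_Icc.mpr ⟨Nat.div_pos (Nat.gcd_le_left _ hm1) (Nat.gcd_pos_of_pos_left _ hm1), hmr⟩⟩
  refine le_trans (le_of_eq ?_) (sum_le_sum_of_subset_of_nonneg hsub fun p _ _ => by positivity)
  rw [sum_image hinj, hS, sum_filter]
  refine sum_congr rfl fun m hm => ?_
  have hm1 := (mem_Icc.mp hm).1
  rw [splitCount]
  split_ifs
  · obtain ⟨j, rfl⟩ : ∃ j, k = j + 1 := ⟨k - 1, by omega⟩
    have hg : (0 : ℝ) < (m.gcd q : ℕ) := Nat.cast_pos.mpr (Nat.gcd_pos_of_pos_left _ hm1)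
    have hm0 : (0 : ℝ) < m := Nat.cast_pos.mpr hm1
    rw [Nat.cast_div (Nat.gcd_dvd_left m q) hg.ne', Nat.add_sub_cancel, pow_succ]
    field_simp
  · rw [Nat.cast_zero, zero_pow (by omega), zero_div]

theorem cycleMoment_le_compoundMoment {q : ℕ} (hq : 0 < q) (n r k : ℕ) :
    cycleMoment n q r k ≤
      compoundMoment (fun j => (ArithmeticFunction.sigma (j - 1) q : ℝ) * (harmonic r : ℝ)) k := by
  have h := mean_perm_eq_sum_partitionMultisets n
    fun s => (s.map fun m => (splitCount q r m : ℝ)).sum ^ k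
  have hc : cycleMoment n q r k = (1 / (n.factorial : ℝ)) * ∑ π : Equiv.Perm (Fin n),
      (π.partition.parts.map fun m => (splitCount q r m : ℝ)).sum ^ k := by
    rw [cycleMoment]
    congr 1
    refine sum_congr rfl fun π _ => ?_
    rw [sum_cycleCount_pow π hq, Nat.cast_multiset_sum, Multiset.map_map]
    rfl
  rw [hc, h]
  exact sum_partitionMultisets_pow_le_compoundMoment (fun m => Nat.cast_nonneg _)
    (fun j n hj => sum_splitCount_pow_div_le hq r j n hj) k n

/-! ### Bounds for divisor functions -/

theorem add_one_le_mul_two_pow_rpow {ε : ℝ} (hε : 0 < ε) (a : ℕ) :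
    (a + 1 : ℝ) ≤ (1 + 1 / (ε * Real.log 2)) * ((2 : ℝ) ^ a) ^ ε := by
  have hl : 0 < ε * Real.log 2 := mul_pos hε (Real.log_pos one_lt_two)
  have h1 : a * (ε * Real.log 2) + 1 ≤ ((2 : ℝ) ^ a) ^ ε := by
    rw [Real.rpow_def_of_pos (by positivity), Real.log_pow]
    refine le_trans (le_of_eq ?_) (Real.add_one_le_exp _)
    ring
  refine le_trans ?_ (mul_le_mul_of_nonneg_left h1 (by positivity))
  have h2 : (1 + 1 / (ε * Real.log 2)) * (a * (ε * Real.log 2) + 1) =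
      a + 1 + (a * (ε * Real.log 2) + 1 / (ε * Real.log 2)) := by
    field_simp
    ring
  rw [h2]
  have : 0 ≤ a * (ε * Real.log 2) + 1 / (ε * Real.log 2) := by positivity
  linarith

theorem exists_card_divisors_le_mul_rpow {ε : ℝ} (hε : 0 < ε) :
    ∃ K : ℝ, ∀ n : ℕ, 0 < n → (#n.divisors : ℝ) ≤ K * (n : ℝ) ^ ε := by
  set K₀ : ℝ := 1 + 1 / (ε * Real.log 2) with hK₀
  have hl : 0 < ε * Real.log 2 := mul_pos hε (Real.log_pos one_lt_two)
  have hK₀1 : 1 ≤ K₀ := by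
    have : 0 ≤ 1 / (ε * Real.log 2) := by positivity
    linarith
  obtain ⟨P, hP⟩ : ∃ P : ℕ, ∀ p : ℕ, P ≤ p → (2 : ℝ) ≤ (p : ℝ) ^ ε := by
    have := ((tendsto_rpow_atTop hε).comp tendsto_natCast_atTop_atTop).eventually_ge_atTop 2
    exact Filter.eventually_atTop.mp this
  refine ⟨K₀ ^ P, fun n hn => ?_⟩
  -- Only primes below P, where p^ε may be less than 2, cost a factor `K₀`.
  have hlocal : ∀ p ∈ n.primeFactors, (n.factorization p + 1 : ℝ) ≤
      (if p < P then K₀ else 1) * ((p : ℝ) ^ n.factorization p) ^ ε := by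
    intro p hp
    have hp2 : (2 : ℝ) ≤ p := by exact_mod_cast (Nat.prime_of_mem_primeFactors hp).two_le
    split_ifs with h
    · refine (add_one_le_mul_two_pow_rpow hε _).trans ?_
      gcongr
    · rw [one_mul, ← Real.rpow_natCast, ← Real.rpow_mul (by linarith), mul_comm,
        Real.rpow_mul (by linarith), Real.rpow_natCast]
      calc (n.factorization p + 1 : ℝ) ≤ 2 ^ n.factorization p := by
            exact_mod_cast Nat.lt_two_pow_self
        _ ≤ _ := pow_le_pow_left₀ zero_le_two (hP p (not_lt.mp h)) _
  have hprod : (n : ℝ) ^ ε = ∏ p ∈ n.primeFactors, ((p : ℝ) ^ n.factorization p) ^ ε := by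
    rw [Real.finsetProd_rpow _ _ fun p _ => by positivity]
    congr 1
    conv_lhs => rw [← Nat.prod_factorization_pow_eq_self hn.ne']
    rw [Finsupp.prod]
    push_cast
    rfl
  have hconst : ∏ p ∈ n.primeFactors, (if p < P then K₀ else 1) ≤ K₀ ^ P := by
    rw [prod_ite, prod_const, prod_const_one, mul_one]
    refine pow_le_pow_right₀ hK₀1 ?_
    calc _ ≤ #(range P) := card_le_card fun p hp => mem_range.mpr (mem_filter.mp hp).2
      _ = P := card_range P
  rw [Nat.card_divisors hn.ne']
  push_cast
  refine (prod_le_prod (fun p _ => by positivity) hlocal).trans ?_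
  rw [prod_mul_distrib, ← hprod]
  gcongr

theorem eventually_card_divisors_le_rpow {ε : ℝ} (hε : 0 < ε) :
    ∀ᶠ n : ℕ in Filter.atTop, (#n.divisors : ℝ) ≤ (n : ℝ) ^ ε := by
  obtain ⟨K, hK⟩ := exists_card_divisors_le_mul_rpow (half_pos hε)
  filter_upwards [Filter.eventually_gt_atTop 0,
    ((tendsto_rpow_atTop (half_pos hε)).comp tendsto_natCast_atTop_atTop).eventually_ge_atTop K]
    with n hn hKn
  have hn' : (0 : ℝ) < n := Nat.cast_pos.mpr hn
  refine (hK n hn).trans ?_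
  refine (mul_le_mul_of_nonneg_right hKn (by positivity)).trans (le_of_eq ?_)
  rw [Function.comp_apply, ← Real.rpow_add hn', add_halves]

theorem sum_Icc_one_div_sq_le (n : ℕ) : ∑ d ∈ Icc 1 n, (1 : ℝ) / (d : ℝ) ^ 2 ≤ 2 := by
  have h := sum_Ioo_inv_sq_le (α := ℝ) 0 (n + 1)
  have hI : Ioo 0 (n + 1) = Icc 1 n := by ext; simp; omega
  rw [hI] at h
  simpa using h

/-- Replacing d by q/d gives σ_k(q) = q^k ∑ d^(-k), and the sum is at most ∑ 1/d² ≤ 2. -/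
theorem sigma_le_two_mul_pow (q : ℕ) {k : ℕ} (hk : 2 ≤ k) :
    (ArithmeticFunction.sigma k q : ℝ) ≤ 2 * (q : ℝ) ^ k := by
  rcases q.eq_zero_or_pos with rfl | hq
  · simp
  have hq' : (0 : ℝ) < q := Nat.cast_pos.mpr hq
  rw [ArithmeticFunction.sigma_apply, ← Nat.sum_div_divisors]
  push_cast
  calc ∑ d ∈ q.divisors, ((q / d : ℕ) : ℝ) ^ k ≤ ∑ d ∈ q.divisors, (q : ℝ) ^ k * (1 / (d : ℝ) ^ 2) := by
        refine sum_le_sum fun d hd => ?_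
        have hd' := Nat.mem_divisors.mp hd
        have hd1 : (1 : ℝ) ≤ d := by exact_mod_cast Nat.pos_of_mem_divisors hd
        rw [Nat.cast_div hd'.1 (by positivity), div_pow, mul_one_div]
        gcongr
    _ ≤ ∑ d ∈ Icc 1 q, (q : ℝ) ^ k * (1 / (d : ℝ) ^ 2) := by
        refine sum_le_sum_of_subset_of_nonneg (fun d hd => mem_Icc.mpr
          ⟨Nat.pos_of_mem_divisors hd, Nat.divisor_le hd⟩) fun _ _ _ => by positivity
    _ ≤ _ := by
        rw [← mul_sum, mul_comm]
        gcongr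
        exact sum_Icc_one_div_sq_le q

theorem sigma_le_card_divisors_mul_pow (q k : ℕ) :
    (ArithmeticFunction.sigma k q : ℝ) ≤ #q.divisors * (q : ℝ) ^ k := by
  rw [ArithmeticFunction.sigma_apply, ← nsmul_eq_mul]
  push_cast
  refine sum_le_card_nsmul _ _ _ fun d hd => ?_
  gcongr
  exact Nat.divisor_le hd

/-! ### Estimating compound moments by number of blocks -/

theorem compoundMoment_pow_mul (c : ℝ) (x : ℕ → ℝ) (k : ℕ) :
    compoundMoment (fun j => c ^ j * x j) k = c ^ k * compoundMoment x k := by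
  induction k using Nat.strong_induction_on with
  | _ k ih =>
  rcases k with _ | k
  · simp [compoundMoment]
  · rw [compoundMoment_succ, compoundMoment_succ, mul_sum]
    refine sum_congr rfl fun i hi => ?_
    have hi := mem_range.mp hi
    rw [ih i hi, show c ^ (k + 1) = c ^ (k + 1 - i) * c ^ i by rw [← pow_add]; congr 1; omega]
    ring

theorem compoundMoment_congr {x y : ℕ → ℝ} (h : ∀ k, 1 ≤ k → x k = y k) (k : ℕ) :
    compoundMoment x k = compoundMoment y k := by
  induction k using Nat.strong_induction_on with
  | _ k ih =>
  rcases k with _ | k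
  · simp [compoundMoment]
  · rw [compoundMoment_succ, compoundMoment_succ]
    refine sum_congr rfl fun i hi => ?_
    have hi := mem_range.mp hi
    rw [ih i hi, h _ (by omega)]

/-- Adjoining one block to k blocks: (k+1)^(N+1) / (k+1)! = ∑ binom(N,i) k^i / k!, by the binomial
theorem for (k+1)^N. -/
theorem sum_choose_mul_sum_Ico_le {l : ℝ} (hl : 0 ≤ l) (N : ℕ) :
    ∑ i ∈ Ico 1 (N + 1), (N.choose i : ℝ) * l *
        ∑ k ∈ Ico 2 (i + 1), (k : ℝ) ^ i * l ^ k / k.factorial ≤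
      ∑ k ∈ Ico 3 (N + 2), (k : ℝ) ^ (N + 1) * l ^ k / k.factorial := by
  calc _ ≤ ∑ i ∈ Ico 1 (N + 1), (N.choose i : ℝ) * l *
        ∑ k ∈ Ico 2 (N + 1), (k : ℝ) ^ i * l ^ k / k.factorial := by
        gcongr with i hi
        have := mem_Ico.mp hi
        omega
    _ ≤ ∑ i ∈ range (N + 1), (N.choose i : ℝ) * l *
        ∑ k ∈ Ico 2 (N + 1), (k : ℝ) ^ i * l ^ k / k.factorial := by
        refine sum_le_sum_of_subset_of_nonneg (fun i hi => mem_range.mpr (mem_Ico.mp hi).2)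
          fun _ _ _ => mul_nonneg (by positivity) (sum_nonneg fun _ _ => by positivity)
    _ = ∑ k ∈ Ico 2 (N + 1), ((k + 1 : ℕ) : ℝ) ^ (N + 1) * l ^ (k + 1) / (k + 1).factorial := by
        simp_rw [mul_sum]
        rw [sum_comm]
        refine sum_congr rfl fun k _ => ?_
        have h : ((k + 1 : ℕ) : ℝ) ^ (N + 1) = (k + 1) * ∑ i ∈ range (N + 1), (k : ℝ) ^ i * N.choose i := by
          rw [pow_succ']
          push_cast
          rw [add_pow]
          simp
        have hf : (0 : ℝ) < k.factorial := Nat.cast_pos.mpr k.factorial_pos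
        rw [h, Nat.factorial_succ, mul_sum, sum_mul, sum_div]
        refine sum_congr rfl fun i _ => ?_
        push_cast
        field_simp
        ring
    _ = _ := by
        rw [sum_Ico_add' (fun k : ℕ => (k : ℝ) ^ (N + 1) * l ^ k / k.factorial) 2 (N + 1) 1]

/-- The three terms account for set partitions of N + 1 points into one, two, and at least three
blocks. Only the last uses the crude bound x ≤ l, together with S(N+1,k) ≤ (k^(N+1)) / k!. -/
theorem compoundMoment_succ_le {x : ℕ → ℝ} {l : ℝ} (hx0 : ∀ k, 1 ≤ k → 0 ≤ x k)
    (hxl : ∀ k, 1 ≤ k → x k ≤ l) (N : ℕ) :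
    compoundMoment x (N + 1) ≤ x (N + 1) +
      ∑ i ∈ Ico 1 (N + 1), (N.choose i : ℝ) * x (N + 1 - i) * x i +
      ∑ k ∈ Ico 3 (N + 2), (k : ℝ) ^ (N + 1) * l ^ k / k.factorial := by
  have hl : 0 ≤ l := (hx0 1 le_rfl).trans (hxl 1 le_rfl)
  induction N using Nat.strong_induction_on with
  | _ N ih =>
  -- A coarser form of the induction hypothesis: the two-block sum is at most 2^j l², which is the k
  -- = 2 term.
  have htwo : ∀ i, 1 ≤ i → i < N + 1 → compoundMoment x i ≤
      x i + ∑ k ∈ Ico 2 (i + 1), (k : ℝ) ^ i * l ^ k / k.factorial := by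
    intro i hi hiN
    obtain ⟨j, rfl⟩ : ∃ j, i = j + 1 := ⟨i - 1, by omega⟩
    refine (ih j (by omega)).trans ?_
    rw [add_assoc]
    gcongr
    rcases j.eq_zero_or_pos with rfl | hj
    · simp
    rw [sum_eq_sum_Ico_succ_bot (a := 2) (by omega)]
    gcongr
    calc _ ≤ ∑ i ∈ Ico 1 (j + 1), (j.choose i : ℝ) * l * l := by
          refine sum_le_sum fun i hi => ?_
          have := mem_Ico.mp hi
          have h1 := hx0 i (by omega)
          have h2 := hxl i (by omega)
          have h3 := hxl (j + 1 - i) (by omega)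
          gcongr
      _ ≤ ∑ i ∈ range (j + 1), (j.choose i : ℝ) * l * l := by
          refine sum_le_sum_of_subset_of_nonneg (fun i hi => mem_range.mpr (mem_Ico.mp hi).2)
            fun _ _ _ => by positivity
      _ = _ := by
          rw [← sum_mul, ← sum_mul]
          have := congrArg (Nat.cast (R := ℝ)) (Nat.sum_range_choose j)
          push_cast at this
          rw [this]
          simp only [Nat.factorial]
          push_cast
          ring
  rw [compoundMoment_succ, range_eq_Ico, sum_eq_sum_Ico_succ_bot (by omega)]
  simp only [Nat.choose_zero_right, Nat.cast_one, one_mul, Nat.sub_zero, zero_add]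
  rw [show compoundMoment x 0 = 1 by rw [compoundMoment], mul_one, add_assoc]
  gcongr
  refine le_trans ?_ (add_le_add_right (sum_choose_mul_sum_Ico_le hl N) _)
  rw [← sum_add_distrib]
  refine sum_le_sum fun i hi => ?_
  have := mem_Ico.mp hi
  have h1 := hx0 (N + 1 - i) (by omega)
  have h2 := hxl (N + 1 - i) (by omega)
  have h3 : 0 ≤ ∑ k ∈ Ico 2 (i + 1), (k : ℝ) ^ i * l ^ k / k.factorial :=
    sum_nonneg fun _ _ => by positivity
  calc _ ≤ (N.choose i : ℝ) * x (N + 1 - i) *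
        (x i + ∑ k ∈ Ico 2 (i + 1), (k : ℝ) ^ i * l ^ k / k.factorial) := by
        gcongr
        exact htwo i this.1 this.2
    _ ≤ _ := by
        rw [mul_add]
        gcongr

theorem sum_choose_mul_two_add_le {s : ℝ} (hs : 0 ≤ s) (N : ℕ) :
    ∑ i ∈ range (N + 1), (N.choose i : ℝ) * (2 + 4 * s * (1 / 2) ^ (N + 1 - i)) *
        (2 + 4 * s * (1 / 2) ^ i) ≤
      2 * 2 ^ (N + 1) + 12 * (s * (3 / 2) ^ (N + 1)) + 8 * s ^ 2 := by
  have h1 : ∑ i ∈ range (N + 1), (N.choose i : ℝ) = 2 ^ N := by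
    exact_mod_cast Nat.sum_range_choose N
  have h2 : ∑ i ∈ range (N + 1), (N.choose i : ℝ) * (1 / 2) ^ i = (3 / 2) ^ N := by
    rw [show (3 / 2 : ℝ) = 1 / 2 + 1 by norm_num, add_pow]
    simp [mul_comm]
  have h3 : ∑ i ∈ range (N + 1), (N.choose i : ℝ) * (1 / 2) ^ (N - i) = (3 / 2) ^ N := by
    rw [show (3 / 2 : ℝ) = 1 + 1 / 2 by norm_num, add_pow]
    simp [mul_comm]
  have h4 : ∀ i ∈ range (N + 1), (N.choose i : ℝ) * (2 + 4 * s * (1 / 2) ^ (N + 1 - i)) *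
        (2 + 4 * s * (1 / 2) ^ i) =
      4 * (N.choose i : ℝ) + 8 * s * ((N.choose i : ℝ) * (1 / 2) ^ i) +
        4 * s * ((N.choose i : ℝ) * (1 / 2) ^ (N - i)) +
        8 * s ^ 2 * (1 / 2) ^ N * (N.choose i : ℝ) := by
    intro i hi
    have hi := mem_range.mp hi
    have h5 : (1 / 2 : ℝ) ^ N = (1 / 2) ^ (N - i) * (1 / 2) ^ i := by
      rw [← pow_add]; congr 1; omega
    rw [show N + 1 - i = (N - i) + 1 by omega, pow_succ, h5]
    ring
  rw [sum_congr rfl h4, sum_add_distrib, sum_add_distrib, sum_add_distrib, ← mul_sum, ← mul_sum,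
    ← mul_sum, ← mul_sum, h1, h2, h3]
  have h6 : (1 / 2 : ℝ) ^ N * 2 ^ N = 1 := by rw [← mul_pow]; norm_num
  have h7 : (0 : ℝ) ≤ s * (3 / 2) ^ N := by positivity
  rw [mul_assoc (8 * s ^ 2), h6, pow_succ (2 : ℝ), pow_succ (3 / 2 : ℝ)]
  linarith

/-- For k ≥ 4, k² ≤ 2^k gives k^N ≤ q^(k/2), so each term is at most (√q l)^k / k! ≤ (q l²)² / k!.
This fails at k = 3, since 9 > 8. -/
theorem sum_Ico_four_pow_mul_pow_div_factorial_le {q l : ℝ} (hq : 0 ≤ q) (hl : 0 ≤ l)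
    (hql : q * l ^ 2 ≤ 1) {N : ℕ} (hN : (2 : ℝ) ^ N ≤ q) (M : ℕ) :
    ∑ k ∈ Ico 4 M, (k : ℝ) ^ N * l ^ k / k.factorial ≤ 3 * (q * l ^ 2) ^ 2 := by
  have hsq : ∀ k : ℕ, 4 ≤ k → k ^ 2 ≤ 2 ^ k := by
    intro k hk
    induction k, hk using Nat.le_induction with
    | base => norm_num
    | succ k hk ih => rw [pow_succ 2 k]; nlinarith
  set y := Real.sqrt q * l with hy
  have hy2 : y ^ 2 = q * l ^ 2 := by rw [hy, mul_pow, Real.sq_sqrt hq]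
  have hy0 : 0 ≤ y := by positivity
  have hy1 : y ≤ 1 := by
    rw [← hy2] at hql
    exact (sq_le_one_iff₀ hy0).mp hql
  have hterm : ∀ k ∈ Ico 4 M, (k : ℝ) ^ N * l ^ k / k.factorial ≤
      (q * l ^ 2) ^ 2 * (1 ^ k / k.factorial) := by
    intro k hk
    have hk4 := (mem_Ico.mp hk).1
    have h1 : (k : ℝ) ^ N ≤ Real.sqrt q ^ k := by
      refine pow_le_pow_iff_left₀ (by positivity) (by positivity) two_ne_zero |>.mp ?_
      calc ((k : ℝ) ^ N) ^ 2 = ((k : ℝ) ^ 2) ^ N := by ring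
        _ ≤ ((2 : ℝ) ^ k) ^ N := by
            gcongr
            exact_mod_cast hsq k hk4
        _ = ((2 : ℝ) ^ N) ^ k := by rw [← pow_mul, ← pow_mul, mul_comm]
        _ ≤ q ^ k := by gcongr
        _ = (Real.sqrt q ^ k) ^ 2 := by rw [← pow_mul, mul_comm k, pow_mul, Real.sq_sqrt hq]
    rw [one_pow, mul_one_div]
    gcongr
    calc (k : ℝ) ^ N * l ^ k ≤ Real.sqrt q ^ k * l ^ k := by gcongr
      _ = y ^ k := by rw [← mul_pow]
      _ ≤ y ^ 4 := pow_le_pow_of_le_one hy0 hy1 hk4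
      _ = _ := by rw [← hy2]; ring
  refine (sum_le_sum hterm).trans ?_
  rw [← mul_sum, mul_comm]
  gcongr
  calc ∑ k ∈ Ico 4 M, (1 : ℝ) ^ k / k.factorial ≤ ∑ k ∈ range M, (1 : ℝ) ^ k / k.factorial :=
        sum_le_sum_of_subset_of_nonneg (fun i hi => mem_range.mpr (mem_Ico.mp hi).2)
          fun _ _ _ => by positivity
    _ ≤ Real.exp 1 := Real.sum_le_exp_of_nonneg zero_le_one M
    _ ≤ 3 := by have := Real.exp_one_lt_d9; linarith

theorem pow_le_pow_of_two_pow_le {a c : ℝ} {m : ℕ} (hc : 0 ≤ c) (hc5 : c ^ 5 ≤ 2 ^ m)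
    (ha : 0 ≤ a) {N : ℕ} (hN : (2 : ℝ) ^ N ≤ a ^ 60) : c ^ N ≤ a ^ (12 * m) := by
  refine pow_le_pow_iff_left₀ (by positivity) (by positivity) (show 5 ≠ 0 by norm_num) |>.mp ?_
  calc (c ^ N) ^ 5 = (c ^ 5) ^ N := by ring
    _ ≤ (2 ^ m) ^ N := by gcongr
    _ = (2 ^ N) ^ m := by rw [← pow_mul, ← pow_mul, mul_comm]
    _ ≤ (a ^ 60) ^ m := by gcongr
    _ = _ := by rw [← pow_mul, ← pow_mul]; congr 1; ring

/-- Here a^60 plays the role of q, s of σ_0(q) and h of H_r. One, two and at least three blocks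
contribute 2, 22 and 4 times h² / a^60. -/
theorem compoundMoment_le_of_four_le {a s h : ℝ} (ha : 1 ≤ a) (hs0 : 0 ≤ s) (hs : s ≤ a)
    (hh1 : 1 ≤ h) (hh : h ≤ a ^ 21) {y : ℕ → ℝ} (hy0 : ∀ k, 0 ≤ y k) (hys : ∀ k, y k ≤ s)
    (hy2 : ∀ k, 3 ≤ k → y k ≤ 2) {N : ℕ} (hN3 : 3 ≤ N) (hN : (2 : ℝ) ^ (N + 1) ≤ a ^ 60) :
    compoundMoment (fun k => h / a ^ 60 * y k) (N + 1) ≤ 36 * (h ^ 2 / a ^ 60) := by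
  have ha0 : 0 < a := by linarith
  have hmain := compoundMoment_succ_le (x := fun k => h / a ^ 60 * y k) (l := h / a ^ 60 * s)
    (fun k _ => mul_nonneg (by positivity) (hy0 k))
    (fun k _ => mul_le_mul_of_nonneg_left (hys k) (by positivity)) N
  -- The factor 4 makes the second term at least s for k ≤ 2; the geometric form lets the binomial
  -- sums be evaluated.
  have hdecay : ∀ k, 1 ≤ k → y k ≤ 2 + 4 * s * (1 / 2) ^ k := by
    intro k hk
    rcases lt_or_ge k 3 with h3 | h3
    · have := hys k
      interval_cases k <;> norm_num <;> linarith
    · have : 0 ≤ 4 * s * (1 / 2) ^ k := by positivity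
      linarith [hy2 k h3]
  have hone : h / a ^ 60 * y (N + 1) ≤ 2 * (h ^ 2 / a ^ 60) := by
    calc h / a ^ 60 * y (N + 1) ≤ h / a ^ 60 * 2 := by gcongr; exact hy2 _ (by omega)
      _ = 2 * (h * 1 / a ^ 60) := by ring
      _ ≤ 2 * (h ^ 2 / a ^ 60) := by rw [sq]; gcongr
  have htwo : ∑ i ∈ Ico 1 (N + 1),
      (N.choose i : ℝ) * (h / a ^ 60 * y (N + 1 - i)) * (h / a ^ 60 * y i) ≤
        22 * (h ^ 2 / a ^ 60) := by
    have hs1 : s * (3 / 2) ^ (N + 1) ≤ a ^ 60 := by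
      calc s * (3 / 2) ^ (N + 1) ≤ a * a ^ (12 * 3) := by
            gcongr
            exact pow_le_pow_of_two_pow_le (by norm_num) (by norm_num) ha0.le hN
        _ = a ^ 37 := by ring
        _ ≤ a ^ 60 := pow_le_pow_right₀ ha (by norm_num)
    have hs2 : s ^ 2 ≤ a ^ 60 := by
      calc s ^ 2 ≤ a ^ 2 := by gcongr
        _ ≤ a ^ 60 := pow_le_pow_right₀ ha (by norm_num)
    calc _ = (h / a ^ 60) ^ 2 * ∑ i ∈ Ico 1 (N + 1), (N.choose i : ℝ) * y (N + 1 - i) * y i := by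
          rw [mul_sum]
          exact sum_congr rfl fun i _ => by ring
      _ ≤ (h / a ^ 60) ^ 2 * ∑ i ∈ Ico 1 (N + 1),
          (N.choose i : ℝ) * (2 + 4 * s * (1 / 2) ^ (N + 1 - i)) * (2 + 4 * s * (1 / 2) ^ i) := by
          refine mul_le_mul_of_nonneg_left (sum_le_sum fun i hi => ?_) (by positivity)
          have := mem_Ico.mp hi
          exact mul_le_mul (mul_le_mul_of_nonneg_left (hdecay _ (by omega)) (by positivity))
            (hdecay _ (by omega)) (hy0 i) (by positivity)
      _ ≤ (h / a ^ 60) ^ 2 * ∑ i ∈ range (N + 1),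
          (N.choose i : ℝ) * (2 + 4 * s * (1 / 2) ^ (N + 1 - i)) * (2 + 4 * s * (1 / 2) ^ i) := by
          refine mul_le_mul_of_nonneg_left (sum_le_sum_of_subset_of_nonneg
            (fun i hi => mem_range.mpr (mem_Ico.mp hi).2) fun _ _ _ => by positivity)
            (by positivity)
      _ ≤ (h / a ^ 60) ^ 2 * (2 * a ^ 60 + 12 * a ^ 60 + 8 * a ^ 60) := by
          gcongr
          refine (sum_choose_mul_two_add_le hs0 N).trans ?_
          gcongr
      _ = _ := by
          field_simp
          ring
  have hfour : h ^ 2 * s ^ 4 ≤ a ^ 60 := by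
    calc h ^ 2 * s ^ 4 ≤ (a ^ 21) ^ 2 * a ^ 4 := by gcongr
      _ = a ^ 46 := by ring
      _ ≤ a ^ 60 := pow_le_pow_right₀ ha (by norm_num)
  have hthree : ∑ k ∈ Ico 3 (N + 2), (k : ℝ) ^ (N + 1) * (h / a ^ 60 * s) ^ k / k.factorial ≤
      4 * (h ^ 2 / a ^ 60) := by
    rw [sum_eq_sum_Ico_succ_bot (by omega)]
    have h3 : ((3 : ℕ) : ℝ) ^ (N + 1) * (h / a ^ 60 * s) ^ 3 / (Nat.factorial 3 : ℕ) ≤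
        1 * (h ^ 2 / a ^ 60) := by
      calc _ ≤ ((3 : ℕ) : ℝ) ^ (N + 1) * (h / a ^ 60 * s) ^ 3 / 1 := by
            gcongr
            exact_mod_cast Nat.factorial_pos 3
        _ = (3 : ℝ) ^ (N + 1) * (h * s ^ 3) / a ^ 120 * (h ^ 2 / a ^ 60) := by
            push_cast
            field_simp
        -- Since 3^5 ≤ 2^8, 3^(N+1) ≤ a^96. The exponents balance exactly, 96 + 21 + 3 = 120; this
        -- is the tightest use of the exponent 1/60.
        _ ≤ (a ^ (12 * 8) * (a ^ 21 * a ^ 3)) / a ^ 120 * (h ^ 2 / a ^ 60) := by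
            gcongr
            exact pow_le_pow_of_two_pow_le (by norm_num) (by norm_num) ha0.le hN
        _ = _ := by
            field_simp
    have h4 : a ^ 60 * (h / a ^ 60 * s) ^ 2 = h ^ 2 * s ^ 2 / a ^ 60 := by
      field_simp
    have hle1 : a ^ 60 * (h / a ^ 60 * s) ^ 2 ≤ 1 := by
      rw [h4, div_le_one (by positivity)]
      calc h ^ 2 * s ^ 2 ≤ (a ^ 21) ^ 2 * a ^ 2 := by gcongr
        _ = a ^ 44 := by ring
        _ ≤ a ^ 60 := pow_le_pow_right₀ ha (by norm_num)
    have h5 := sum_Ico_four_pow_mul_pow_div_factorial_le (q := a ^ 60) (l := h / a ^ 60 * s)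
      (by positivity) (by positivity) hle1 hN (N + 2)
    have h6 : (a ^ 60 * (h / a ^ 60 * s) ^ 2) ^ 2 ≤ h ^ 2 / a ^ 60 := by
      rw [h4]
      calc _ = h ^ 2 * (h ^ 2 * s ^ 4) / (a ^ 60 * a ^ 60) := by field_simp
        _ ≤ h ^ 2 * a ^ 60 / (a ^ 60 * a ^ 60) := by gcongr
        _ = _ := by field_simp
    have h7 : 3 * (a ^ 60 * (h / a ^ 60 * s) ^ 2) ^ 2 ≤ 3 * (h ^ 2 / a ^ 60) := by gcongr
    norm_num only at h3 h5 ⊢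
    linarith
  have hnn : 0 ≤ h ^ 2 / a ^ 60 := by positivity
  linarith
-- The moment bounds
theorem mainTheorem7 :
    ∃ C : ℝ, 0 < C ∧ ∃ q₀ : ℕ, ∀ q : ℕ, q₀ ≤ q →
      ∀ r : ℕ, 1 ≤ r → (r : ℝ) ≤ Real.exp ((q : ℝ) ^ (1 / 3 : ℝ)) →
      ∀ δ : ℕ, 1 ≤ δ → (δ : ℝ) ≤ Real.log (q : ℝ) / Real.log 2 →
      ∀ n : ℕ, 1 ≤ n →
        (δ = 1 → cycleMoment n q r δ ≤
          C * ((ArithmeticFunction.sigma 0 q : ℝ) * (harmonic r : ℝ))) ∧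
        (δ = 2 → cycleMoment n q r δ ≤
          C * ((ArithmeticFunction.sigma 0 q : ℝ) ^ 2 * (harmonic r : ℝ) ^ 2
            + (ArithmeticFunction.sigma 1 q : ℝ) * (harmonic r : ℝ))) ∧
        (δ = 3 → cycleMoment n q r δ ≤ C * ((q : ℝ) ^ 2 * (harmonic r : ℝ))) ∧
        (4 ≤ δ → cycleMoment n q r δ ≤ C * ((q : ℝ) ^ (δ - 1) * (harmonic r : ℝ) ^ 2)) := by
  obtain ⟨Q₁, hQ₁⟩ := Filter.eventually_atTop.mp
    (eventually_card_divisors_le_rpow (show (0 : ℝ) < 1 / 60 by norm_num))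
  refine ⟨36, by norm_num, max Q₁ (2 ^ 60), ?_⟩
  intro q hq r hr hrexp δ hδ hδq n _
  have hs := hQ₁ q ((le_max_left _ _).trans hq)
  have hq60 : ((2 : ℝ) ^ 60) ≤ q := by exact_mod_cast (le_max_right _ _).trans hq
  have hq0 : (0 : ℝ) < q := lt_of_lt_of_le (by positivity) hq60
  have hqpos : 0 < q := Nat.cast_pos.mp hq0
  set a : ℝ := (q : ℝ) ^ (1 / 60 : ℝ) with ha
  have hapow : ∀ k : ℕ, a ^ k = (q : ℝ) ^ ((k : ℝ) / 60) := fun k => by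
    rw [ha, ← Real.rpow_natCast, ← Real.rpow_mul hq0.le]
    congr 1
    ring
  have ha60 : a ^ 60 = q := by rw [hapow]; norm_num
  have ha20 : a ^ 20 = (q : ℝ) ^ (1 / 3 : ℝ) := by rw [hapow]; norm_num
  have ha0 : 0 < a := by positivity
  have ha2 : 2 ≤ a := by
    refine pow_le_pow_iff_left₀ zero_le_two ha0.le (show 60 ≠ 0 by norm_num) |>.mp ?_
    rw [ha60]; exact hq60
  have ha1 : 1 ≤ a := by linarith
  have hr0 : (0 : ℝ) < r := Nat.cast_pos.mpr hr
  set h : ℝ := (harmonic r : ℝ) with hh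
  have hh1 : 1 ≤ h := by
    have h1 : harmonic 1 ≤ harmonic r := by
      rw [harmonic_eq_sum_Icc, harmonic_eq_sum_Icc]
      exact sum_le_sum_of_subset_of_nonneg (Icc_subset_Icc_right hr) fun _ _ _ => by positivity
    have h2 : harmonic 1 = 1 := by simp [harmonic]
    rw [h2] at h1
    rw [hh]
    exact_mod_cast h1
  -- H_r ≤ 1 + log r ≤ 2 q^(1/3) = 2 a^20, and q ≥ 2^60 gives 2 ≤ a.
  have hh21 : h ≤ a ^ 21 := by
    have h1 : Real.log r ≤ a ^ 20 := by
      rw [ha20]; exact (Real.log_le_iff_le_exp hr0).mpr hrexp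
    have h2 : (1 : ℝ) ≤ a ^ 20 := one_le_pow₀ ha1
    calc h ≤ 1 + Real.log r := harmonic_le_one_add_log r
      _ ≤ 2 * a ^ 20 := by linarith
      _ ≤ a * a ^ 20 := by gcongr
      _ = a ^ 21 := by ring
  have hs0 : (ArithmeticFunction.sigma 0 q : ℝ) = #q.divisors := by
    rw [ArithmeticFunction.sigma_zero_apply]
  set s : ℝ := (#q.divisors : ℝ) with hsdef
  have hs00 : 0 ≤ s := Nat.cast_nonneg _
  have hδ2 : (2 : ℝ) ^ δ ≤ a ^ 60 := by
    rw [ha60]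
    rw [le_div_iff₀ (Real.log_pos one_lt_two), ← Real.log_pow] at hδq
    exact (Real.log_le_log_iff (by positivity) hq0).mp hδq
  have hmoment := cycleMoment_le_compoundMoment hqpos n r
  have hσ1 : (ArithmeticFunction.sigma 1 q : ℝ) ≤ s * q := by
    simpa using sigma_le_card_divisors_mul_pow q 1
  have hσ2 := sigma_le_two_mul_pow q (le_refl 2)
  have hσ10 : (0 : ℝ) ≤ ArithmeticFunction.sigma 1 q := Nat.cast_nonneg _
  set ν : ℕ → ℝ := fun j => (ArithmeticFunction.sigma (j - 1) q : ℝ) * h with hν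
  have hm1 : compoundMoment ν 1 = s * h := by
    simp [compoundMoment_succ, compoundMoment, hν, hs0]
  have hm2 : compoundMoment ν 2 = s ^ 2 * h ^ 2 + ArithmeticFunction.sigma 1 q * h := by
    rw [compoundMoment_succ, sum_range_succ, sum_range_one, hm1]
    simp [compoundMoment, hν, hs0]
    ring
  have hm3 : compoundMoment ν 3 = s ^ 3 * h ^ 3 + 3 * s * ArithmeticFunction.sigma 1 q * h ^ 2 +
      ArithmeticFunction.sigma 2 q * h := by
    rw [compoundMoment_succ, sum_range_succ, sum_range_succ, sum_range_one, hm2, hm1]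
    simp [compoundMoment, hν, hs0]
    ring
  refine ⟨?_, ?_, ?_, ?_⟩
  · rintro rfl
    rw [hs0]
    refine (hmoment 1).trans ?_
    rw [hm1]
    have : 0 ≤ s * h := by positivity
    linarith
  · rintro rfl
    rw [hs0]
    refine (hmoment 2).trans ?_
    rw [hm2]
    have : 0 ≤ s ^ 2 * h ^ 2 + ArithmeticFunction.sigma 1 q * h := by positivity
    linarith
  · rintro rfl
    refine (hmoment 3).trans ?_
    rw [hm3]
    have h1 : s ^ 3 * h ^ 3 ≤ (q : ℝ) ^ 2 * h := by
      calc s ^ 3 * h ^ 3 = s ^ 3 * h ^ 2 * h := by ring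
        _ ≤ a ^ 3 * (a ^ 21) ^ 2 * h := by gcongr
        _ = a ^ 45 * h := by ring
        _ ≤ a ^ 120 * h := by gcongr <;> norm_num [ha1]
        _ = _ := by rw [← ha60]; ring
    have h2 : 3 * s * ArithmeticFunction.sigma 1 q * h ^ 2 ≤ 3 * ((q : ℝ) ^ 2 * h) := by
      calc 3 * s * ArithmeticFunction.sigma 1 q * h ^ 2 ≤ 3 * s * (s * q) * h ^ 2 := by gcongr
        _ = 3 * (s ^ 2 * h * q * h) := by ring
        _ ≤ 3 * (a ^ 2 * a ^ 21 * q * h) := by gcongr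
        _ = 3 * (a ^ 23 * q * h) := by ring
        _ ≤ 3 * (a ^ 60 * q * h) := by gcongr <;> norm_num [ha1]
        _ = _ := by rw [ha60]; ring
    have h3 : ArithmeticFunction.sigma 2 q * h ≤ 2 * ((q : ℝ) ^ 2 * h) := by
      rw [← mul_assoc]; gcongr
    have h4 : 0 ≤ (q : ℝ) ^ 2 * h := by positivity
    linarith
  · intro hδ4
    obtain ⟨N, rfl⟩ : ∃ N, δ = N + 1 := ⟨δ - 1, by omega⟩
    refine (hmoment (N + 1)).trans ?_
    -- Scaling out q^k leaves cumulants (h/q) y k, with y k at most s always and at most 2 for k ≥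
    -- 3.
    set y : ℕ → ℝ := fun k => (ArithmeticFunction.sigma (k - 1) q : ℝ) / (q : ℝ) ^ (k - 1) with hy
    have hscale : compoundMoment ν (N + 1) =
        compoundMoment (fun k => (q : ℝ) ^ k * (h / a ^ 60 * y k)) (N + 1) := by
      refine compoundMoment_congr (fun k hk => ?_) _
      obtain ⟨j, rfl⟩ : ∃ j, k = j + 1 := ⟨k - 1, by omega⟩
      simp only [hν, hy, ha60, Nat.add_sub_cancel, pow_succ]
      field_simp
    rw [hscale, compoundMoment_pow_mul]
    have hb := compoundMoment_le_of_four_le ha1 hs00 hs hh1 hh21 (y := y)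
      (fun k => by positivity)
      (fun k => (div_le_iff₀ (by positivity)).mpr (sigma_le_card_divisors_mul_pow q (k - 1)))
      (fun k hk => (div_le_iff₀ (by positivity)).mpr (sigma_le_two_mul_pow q (by omega)))
      (by omega) hδ2
    refine (mul_le_mul_of_nonneg_left hb (by positivity)).trans (le_of_eq ?_)
    rw [ha60, Nat.add_sub_cancel, pow_succ]
    field_simp
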